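/- Let $p$ be an odd prime, $m\ge 1$, $n=2m$, $q=p^n$, let $\mathrm{Tr}$ be the absolute trace from $\mathbb F_q$ to $\mathbb F_p$ and let $\zeta_p$ be a primitive complex $p$-th root of unity. Let $t$ be a positive integer with $t\equiv 2 \pmod 4$ and $t\not\equiv 0 \pmod{p^m+1}$. Put $s_1=\frac{t+2}{4}$, $s_2=\frac{3t+2}{4}$, $d_1=s_1(p^m-1)+1$, $d_2=s_2(p^m-1)+1$, $l=\gcd(t,p^m+1)$, and for $a,b\in\mathbb F_q$ $$T_2(a,b)=\sum_{x\in\mathbb F_q}\zeta_p^{\mathrm{Tr}(ax^{d_1}+bx^{d_2})}.$$ Then, as $(a,b)$ runs over $\mathbb F_q^2$, $T_2(a,b)$ takes the value $p^{2m}$ exactly once, at $(a,b)=(0,0)$. For $(a,b)\neq(0,0)$ the values taken are exactly the four numbers $-p^m$, $(\frac l2-1)p^m$, $(l-1)p^m$, $(\frac{3l}2-1)p^m$, and each is taken with the following frequency (number of pairs $(a,b)$): - $(\frac{3l}{2}-1)p^m$: $\ \dfrac{2(p^{2m}-1)(l-p^m-1)(l-2p^m-2)}{3l^3}$; - $(l-1)p^m$: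 $\ \dfrac{(p^{2m}-1)(2p^m+2-(p^m+3)l)(l-2p^m-2)}{l^3}$; - $(\frac l2-1)p^m$: $\ \dfrac{2(p^{2m}-1)\left((p^{2m}+2p^m+3)l^2-(2p^{2m}+7p^m+5)l+2(p^m+1)^2\right)}{l^3}$; - $-p^m$: $\ \dfrac{(p^{2m}-1)\left(3(p^{2m}+1)l^3-(6p^{2m}+9p^m+11)l^2+6(p^{2m}+3p^m+2)l-4(p^m+1)^2\right)}{3l^3}$. -/

import Mathlib

/-- The Niho exponent `s (p^m - 1) + 1`. -/
def nihoExponent (p m s : ℕ) : ℕ := s * (p ^ m - 1) + 1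

/-- The exponential sum `T₂(a, b) = ∑_{x ∈ F} ζ^{Tr(a x^{d₁} + b x^{d₂})}`, where `Tr` is the
absolute trace from `F` to the prime field `ZMod p`. -/
noncomputable def expSum (p : ℕ) [Fact p.Prime] {F : Type*} [Field F] [Fintype F]
    [Algebra (ZMod p) F] (ζ : ℂ) (d₁ d₂ : ℕ) (a b : F) : ℂ :=
  ∑ x : F, ζ ^ (Algebra.trace (ZMod p) F (a * x ^ d₁ + b * x ^ d₂)).val

/-- The number of pairs `(a, b) ∈ F × F` at which a function takes the value `v`. -/
noncomputable def frequency {F : Type*} (T : F → F → ℂ) (v : ℂ) : ℕ :=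
  Nat.card {ab : F × F // T ab.1 ab.2 = v}

/-! Write Q = `p ^ m` and t = 4k + 2. Niho exponents are 1 mod Q - 1, so the phase φ(x) = a x^d₁ + b
x^d₂ is homogeneous of degree one under the subfield F_Q. Averaging over F_Q-orbits reduces the sum
to counting the units x with φ(x)^Q + φ(x) = 0 (`sum_traceChar_homogeneous`). In z = x^((Q-1)(2k+1))
this condition is a self-reciprocal cubic (`niho_trace_eq_zero_iff`). Hence T₂ = (gN - 1)Q, where g
= l/2 and N is the number of roots of the cubic in a subgroup H of the unit circle, of order (Q+1)/g
(`expSum_niho`).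

For (a,b) ≠ 0, N ≤ 3. Vanishing at j ≤ 4 points of H leaves exactly Q^(4-j) pairs
(`card_conjCubicVanishing`), so double counting gives the binomial moments of N. These form a
triangular system that determines how often each N occurs (`counts_of_binomial_moments`). -/

open Finset Polynomial

/-- The self-reciprocal cubic `b z³ + a z² + a^Q z + b^Q`. -/
def conjCubic {F : Type*} [Field F] (Q : ℕ) (a b z : F) : F :=
  b * z ^ 3 + a * z ^ 2 + a ^ Q * z + b ^ Q

/-- The pairs `(a, b)` whose self-reciprocal cubic vanishes on `S`. -/
def conjCubicVanishing {F : Type*} [Field F] [Fintype F] [DecidableEq F] (Q : ℕ) (S : Finset F) :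
    Finset (F × F) :=
  univ.filter fun ab => ∀ z ∈ S, conjCubic Q ab.1 ab.2 z = 0

/-! ### Self-reciprocal cubics and their roots on the unit circle -/

section Field
variable {F : Type*} [Field F]

theorem card_le_three_of_conjCubic_eq_zero {Q : ℕ} {a b : F} (hab : (a, b) ≠ 0) (S : Finset F)
    (hS : ∀ z ∈ S, conjCubic Q a b z = 0) : #S ≤ 3 := by
  classical
  let f : F[X] := C b * X ^ 3 + C a * X ^ 2 + C (a ^ Q) * X + C (b ^ Q)
  have hf : f ≠ 0 := by
    intro h
    apply hab
    have h3 : f.coeff 3 = b := by simp [f, -map_pow]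
    have h2 : f.coeff 2 = a := by simp [f, -map_pow]
    rw [h, coeff_zero] at h3 h2
    simp [← h3, ← h2]
  have hsub : S ⊆ f.roots.toFinset := by
    intro z hz
    have := hS z hz
    simp only [Multiset.mem_toFinset, mem_roots hf, IsRoot.def]
    simpa [f, conjCubic] using this
  calc #S ≤ #f.roots.toFinset := card_le_card hsub
    _ ≤ Multiset.card f.roots := Multiset.toFinset_card_le _
    _ ≤ f.natDegree := card_roots' f
    _ ≤ 3 := natDegree_cubic_le

theorem conjCubic_sub {Q : ℕ} (hadd : ∀ x y : F, (x + y) ^ Q = x ^ Q + y ^ Q)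
    (a b a' b' z : F) :
    conjCubic Q (a - a') (b - b') z = conjCubic Q a b z - conjCubic Q a' b' z := by
  have hsub (x y : F) : (x - y) ^ Q = x ^ Q - y ^ Q := by
    rw [eq_sub_iff_add_eq, ← hadd, sub_add_cancel]
  simp only [conjCubic, hsub]
  ring

/-- On the unit circle z^Q = z⁻¹, so conjugation reverses the coefficients. This confines the values
at z to the at most Q solutions of z³v^Q = v. -/
theorem conjCubic_pow {Q : ℕ} (hadd : ∀ x y : F, (x + y) ^ Q = x ^ Q + y ^ Q)
    (hinv : ∀ x : F, (x ^ Q) ^ Q = x) (a b : F) {z : F} (hz : z ^ (Q + 1) = 1) :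
    z ^ 3 * conjCubic Q a b z ^ Q = conjCubic Q a b z := by
  have hzQ : z ^ Q * z = 1 := by rw [← pow_succ, hz]
  simp only [conjCubic, hadd, mul_pow, hinv]
  rw [← pow_mul z 3, ← pow_mul z 2, mul_comm 3 Q, mul_comm 2 Q, pow_mul, pow_mul]
  generalize z ^ Q = v at hzQ
  linear_combination (b ^ Q * (v ^ 2 * z ^ 2 + v * z + 1) + a ^ Q * z * (v * z + 1) + a * z ^ 2) * hzQ

variable [Fintype F] [DecidableEq F]

theorem card_pow_eq_mul_le {Q : ℕ} (hQ : 2 ≤ Q) {c : F} (hc : c ≠ 0) :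
    #{v : F | c * v ^ Q = v} ≤ Q := by
  let f : F[X] := C c * X ^ Q + C (-1) * X
  have hf : f ≠ 0 := by
    intro h
    apply hc
    have h3 : f.coeff Q = c := by simp [f, coeff_X, show 1 ≠ Q by omega]
    rw [h, coeff_zero] at h3
    exact h3.symm
  have hsub : ({v : F | c * v ^ Q = v} : Finset F) ⊆ f.roots.toFinset := by
    intro z hz
    simp only [mem_filter, mem_univ, true_and] at hz
    rw [Multiset.mem_toFinset, mem_roots hf, IsRoot.def]
    simp [f, hz]
  calc _ ≤ #f.roots.toFinset := card_le_card hsub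
    _ ≤ Multiset.card f.roots := Multiset.toFinset_card_le _
    _ ≤ f.natDegree := card_roots' f
    _ ≤ Q := by
      refine natDegree_add_le_of_degree_le (natDegree_C_mul_X_pow_le _ _) ?_
      refine (natDegree_C_mul_le _ _).trans ?_
      rw [natDegree_X]; omega

/-- Evaluation at a unit-circle point is additive with at most Q values, so each new condition cuts
the count by a factor of at most Q. -/
theorem card_conjCubicVanishing_le {Q : ℕ} (hQ : 2 ≤ Q)
    (hadd : ∀ x y : F, (x + y) ^ Q = x ^ Q + y ^ Q) (hinv : ∀ x : F, (x ^ Q) ^ Q = x)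
    (S R : Finset F) (hR : ∀ z ∈ R, z ^ (Q + 1) = 1) :
    #(conjCubicVanishing Q S) ≤ Q ^ #R * #(conjCubicVanishing Q (S ∪ R)) := by
  induction R using Finset.induction_on with
  | empty => simp
  | insert z R hzR ih =>
    have hz : z ^ (Q + 1) = 1 := hR z (mem_insert_self _ _)
    have hz0 : z ≠ 0 := by
      rintro rfl
      simp at hz
    refine (ih fun w hw => hR w (mem_insert_of_mem hw)).trans ?_
    rw [card_insert_of_notMem hzR, pow_succ, mul_assoc]
    refine Nat.mul_le_mul_left _ ?_
    have himage : #((conjCubicVanishing Q (S ∪ R)).image fun ab => conjCubic Q ab.1 ab.2 z) ≤ Q := by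
      refine (card_le_card ?_).trans (card_pow_eq_mul_le hQ (pow_ne_zero 3 hz0))
      intro v hv
      obtain ⟨ab, -, rfl⟩ := mem_image.1 hv
      simpa using conjCubic_pow hadd hinv ab.1 ab.2 hz
    refine (card_le_mul_card_image (f := fun ab : F × F => conjCubic Q ab.1 ab.2 z) _
      #(conjCubicVanishing Q (S ∪ insert z R)) ?_).trans ?_
    -- Subtracting one member of a fibre embeds that fibre in the kernel.
    · intro v hv
      obtain ⟨cd, hcd, rfl⟩ := mem_image.1 hv
      refine card_le_card_of_injOn (fun ab => ab - cd) ?_ (fun x _ y _ h => sub_left_injective h)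
      intro ab hab
      simp only [conjCubicVanishing, coe_filter, mem_filter, mem_univ, true_and, Set.mem_ofPred_eq] at hab hcd ⊢
      intro w hw
      rw [Prod.fst_sub, Prod.snd_sub, conjCubic_sub hadd, sub_eq_zero]
      simp only [mem_union, mem_insert] at hw hab hcd
      rcases hw with hw | rfl | hw
      · rw [hab.1 w (Or.inl hw), hcd w (Or.inl hw)]
      · exact hab.2
      · rw [hab.1 w (Or.inr hw), hcd w (Or.inr hw)]
    · rw [mul_comm]
      exact Nat.mul_le_mul_right _ himage

/-- At most four vanishing conditions at points of the unit circle are independent. -/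
theorem card_conjCubicVanishing {Q : ℕ} (hQ : 2 ≤ Q) (hcard : Fintype.card F = Q ^ 2)
    (hadd : ∀ x y : F, (x + y) ^ Q = x ^ Q + y ^ Q) (hinv : ∀ x : F, (x ^ Q) ^ Q = x)
    (H : Finset F) (hH : ∀ z ∈ H, z ^ (Q + 1) = 1) (hH4 : 4 ≤ #H)
    {S : Finset F} (hSH : S ⊆ H) {k : ℕ} (hS : #S = k) (hk : k ≤ 4) :
    #(conjCubicVanishing Q S) = Q ^ (4 - k) := by
  obtain ⟨R, hSR, hRH, hR⟩ := exists_subsuperset_card_eq hSH (hS.trans_le hk) hH4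
  have hfull : #(conjCubicVanishing Q R) = 1 := by
    rw [card_eq_one]
    refine ⟨0, ?_⟩
    ext ab
    simp only [conjCubicVanishing, mem_filter, mem_univ, true_and, mem_singleton]
    constructor
    · intro h
      by_contra h0
      have := card_le_three_of_conjCubic_eq_zero (a := ab.1) (b := ab.2) h0 R h
      omega
    · rintro rfl z -
      simp [conjCubic, show Q ≠ 0 by omega]
  have hempty : #(conjCubicVanishing (F := F) Q ∅) = Q ^ 4 := by
    simp [conjCubicVanishing, hcard]
    ring
  -- Sandwich: going from ∅ to `S` bounds the count below; going from `S` to the four-point set `R`,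
  -- where only 0 survives, bounds it above.
  have h1 := card_conjCubicVanishing_le hQ hadd hinv ∅ S fun z hz => hH z (hSH hz)
  have h2 := card_conjCubicVanishing_le hQ hadd hinv S (R \ S)
    fun z hz => hH z (hRH (mem_sdiff.1 hz).1)
  rw [empty_union, hempty, hS, ← Nat.add_sub_of_le hk, pow_add] at h1
  rw [union_sdiff_of_subset hSR, hfull, mul_one, card_sdiff_of_subset hSR, hR, hS] at h2
  refine le_antisymm h2 ?_
  have := Nat.le_of_mul_le_mul_left h1 (by positivity)
  simpa using this

/-- Double count of pairs (cubic, k-set of its roots in H). -/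
theorem sum_choose_card_roots {Q : ℕ} (hQ : 2 ≤ Q) (hcard : Fintype.card F = Q ^ 2)
    (hadd : ∀ x y : F, (x + y) ^ Q = x ^ Q + y ^ Q) (hinv : ∀ x : F, (x ^ Q) ^ Q = x)
    (H : Finset F) (hH : ∀ z ∈ H, z ^ (Q + 1) = 1) (hH4 : 4 ≤ #H) {k : ℕ} (hk : k ≤ 4) :
    ∑ ab : F × F, (#{z ∈ H | conjCubic Q ab.1 ab.2 z = 0}).choose k =
      (#H).choose k * Q ^ (4 - k) := by
  have h := sum_card_bipartiteAbove_eq_sum_card_bipartiteBelow (s := (univ : Finset (F × F)))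
    (t := powersetCard k H) fun ab S => ∀ z ∈ S, conjCubic Q ab.1 ab.2 z = 0
  convert h using 1
  · refine sum_congr rfl fun ab _ => ?_
    rw [← card_powersetCard]
    congr 1
    ext S
    simp only [mem_powersetCard, bipartiteAbove, mem_filter, subset_iff]
    grind
  · rw [← card_powersetCard, ← smul_eq_mul, ← sum_const]
    refine sum_congr rfl fun S hS => ?_
    obtain ⟨h1, h2⟩ := mem_powersetCard.1 hS
    exact (card_conjCubicVanishing hQ hcard hadd hinv H hH hH4 h1 h2 hk).symm

/-- The pair (0,0) vanishes on all of H; its contribution is the separate term `(#H).choose k`. -/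
theorem sum_choose_card_roots_ne_zero {Q : ℕ} (hQ : 2 ≤ Q) (hcard : Fintype.card F = Q ^ 2)
    (hadd : ∀ x y : F, (x + y) ^ Q = x ^ Q + y ^ Q) (hinv : ∀ x : F, (x ^ Q) ^ Q = x)
    (H : Finset F) (hH : ∀ z ∈ H, z ^ (Q + 1) = 1) (hH4 : 4 ≤ #H) {k : ℕ} (hk : k ≤ 4) :
    ∑ i ∈ range 4, #{ab : F × F | ab ≠ 0 ∧ #{z ∈ H | conjCubic Q ab.1 ab.2 z = 0} = i} * i.choose k
      + (#H).choose k = (#H).choose k * Q ^ (4 - k) := by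
  rw [← sum_choose_card_roots hQ hcard hadd hinv H hH hH4 hk,
    ← sum_erase_add _ _ (mem_univ (0 : F × F))]
  congr 1
  · rw [← sum_fiberwise_of_maps_to (t := range 4)
      (g := fun ab : F × F => #{z ∈ H | conjCubic Q ab.1 ab.2 z = 0})]
    · refine sum_congr rfl fun i _ => ?_
      rw [← smul_eq_mul, ← sum_const]
      have : (univ.filter fun ab : F × F => ab ≠ 0 ∧ #{z ∈ H | conjCubic Q ab.1 ab.2 z = 0} = i) =
          (univ.erase 0).filter fun ab : F × F => #{z ∈ H | conjCubic Q ab.1 ab.2 z = 0} = i := by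
        ext ab
        simp
      rw [this]
      refine sum_congr rfl fun ab hab => ?_
      rw [(mem_filter.1 hab).2]
    · intro ab hab
      rw [mem_range, Nat.lt_succ_iff]
      exact card_le_three_of_conjCubic_eq_zero (a := ab.1) (b := ab.2) (ne_of_mem_erase hab) _
        fun z hz => (mem_filter.1 hz).2
  · congr 2
    symm
    rw [filter_eq_self]
    intro z _
    simp [conjCubic, show Q ≠ 0 by omega]

end Field

/-! ### Trace characters and orthogonality over the subfield -/

section Trace
variable {p : ℕ} [Fact p.Prime] {F : Type*} [Field F] [Algebra (ZMod p) F]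

/-- The character `x ↦ ζ ^ Tr x` of a finite field. -/
noncomputable def traceChar (F : Type*) [Field F] [Algebra (ZMod p) F]
    {ζ : ℂ} (hζ : ζ ^ p = 1) : AddChar F ℂ :=
  (AddChar.zmodChar p hζ).compAddMonoidHom (Algebra.trace (ZMod p) F).toAddMonoidHom

theorem traceChar_apply {ζ : ℂ} (hζ : ζ ^ p = 1) (x : F) :
    traceChar F hζ x = ζ ^ (Algebra.trace (ZMod p) F x).val := rfl

theorem traceChar_eq_one_iff {ζ : ℂ} (hζ : IsPrimitiveRoot ζ p) (x : F) :
    traceChar F hζ.pow_eq_one x = 1 ↔ Algebra.trace (ZMod p) F x = 0 := by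
  rw [traceChar_apply, hζ.pow_eq_one_iff_dvd, ← ZMod.val_eq_zero]
  exact ⟨fun h => Nat.eq_zero_of_dvd_of_lt h (ZMod.val_lt _), fun h => h ▸ dvd_zero p⟩

variable [Fintype F]

theorem trace_pow_prime_pow (m : ℕ) (x : F) :
    Algebra.trace (ZMod p) F (x ^ p ^ m) = Algebra.trace (ZMod p) F x := by
  induction m with
  | zero => simp
  | succ m ih =>
    rw [← ih, pow_succ, pow_mul]
    have := Algebra.trace_eq_of_algEquiv
      (FiniteField.frobeniusAlgEquivOfAlgebraic (ZMod p) F) (x ^ p ^ m)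
    rwa [FiniteField.coe_frobeniusAlgEquivOfAlgebraic, ZMod.card] at this

theorem trace_mul_fixed_eq_zero_iff [CharP F p] (hp : Odd p) {m : ℕ}
    (hinv : ∀ x : F, (x ^ p ^ m) ^ p ^ m = x) (c : F) :
    (∀ y : F, y ^ p ^ m = y → Algebra.trace (ZMod p) F (y * c) = 0) ↔ c ^ p ^ m + c = 0 := by
  constructor
  · intro h
    by_contra hne
    apply hne
    -- Tr(x(c^Q + c)) = Tr((x^Q + x)c), and x^Q + x is fixed by the Q-power map.
    refine (traceForm_nondegenerate (ZMod p) F).1 _ fun x => ?_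
    rw [Algebra.traceForm_apply, mul_comm, mul_add, map_add, ← trace_pow_prime_pow m (x * c ^ p ^ m),
      mul_pow, hinv, ← map_add, ← add_mul]
    refine h _ ?_
    rw [add_pow_char_pow, hinv, add_comm]
  · intro h y hy
    have h1 := trace_pow_prime_pow (p := p) m (y * c)
    rw [mul_pow, hy, eq_neg_of_add_eq_zero_left h, mul_neg, map_neg, neg_eq_iff_add_eq_zero,
      ← two_mul] at h1
    have h2 : (2 : ZMod p) ≠ 0 := by
      intro h2
      have : p ∣ 2 := (ZMod.natCast_eq_zero_iff 2 p).1 (by exact_mod_cast h2)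
      have h3 := Nat.le_of_dvd two_pos this
      have h4 := (Fact.out : p.Prime).two_le
      have h5 : p = 2 := le_antisymm h3 h4
      subst h5
      exact absurd hp (by decide)
    exact (mul_eq_zero.1 h1).resolve_left h2

theorem sum_traceChar_mul_fixed [CharP F p] [DecidableEq F] (hp : Odd p) {m : ℕ}
    (hinv : ∀ x : F, (x ^ p ^ m) ^ p ^ m = x) {ζ : ℂ} (hζ : IsPrimitiveRoot ζ p) (c : F) :
    ∑ y : F with y ^ p ^ m = y, traceChar F hζ.pow_eq_one (y * c) =
      if c ^ p ^ m + c = 0 then (#{y : F | y ^ p ^ m = y} : ℂ) else 0 := by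
  split_ifs with h
  · rw [← nsmul_one, ← sum_const]
    refine sum_congr rfl fun y hy => ?_
    rw [traceChar_eq_one_iff hζ]
    exact (trace_mul_fixed_eq_zero_iff hp hinv c).2 h y (mem_filter.1 hy).2
  · rw [← trace_mul_fixed_eq_zero_iff hp hinv c] at h
    push Not at h
    obtain ⟨y₀, hy₀, hne⟩ := h
    rw [Ne, ← traceChar_eq_one_iff hζ] at hne
    -- Translation by y₀ multiplies the sum by a character value different from 1.
    refine eq_zero_of_mul_eq_self_left hne ?_
    rw [mul_sum]
    refine sum_nbij' (fun y => y₀ + y) (fun y => y - y₀) ?_ ?_ ?_ ?_ ?_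
    · intro y hy
      simp only [mem_filter, mem_univ, true_and] at hy ⊢
      rw [add_pow_char_pow, hy₀, hy]
    · intro y hy
      simp only [mem_filter, mem_univ, true_and] at hy ⊢
      rw [sub_pow_char_pow, hy₀, hy]
    · intro y _; simp
    · intro y _; simp
    · intro y _
      rw [add_mul, AddChar.map_add_eq_mul]

end Trace

/-! ### Power maps on finite cyclic groups -/

section Cyclic

/-- In a finite cyclic group, counting along a power map multiplies by the size of its kernel. -/
theorem card_filter_pow {G : Type*} [CommGroup G] [IsCyclic G] [Fintype G] [DecidableEq G] (e : ℕ)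
    (P : G → Prop) [DecidablePred P] :
    #{x : G | P (x ^ e)} = (Fintype.card G).gcd e * #{z ∈ univ.image fun x : G => x ^ e | P z} := by
  rw [card_eq_sum_card_fiberwise (f := fun x : G => x ^ e)
    (t := {z ∈ univ.image fun x : G => x ^ e | P z}), mul_comm, ← smul_eq_mul, ← sum_const]
  · refine sum_congr rfl fun z hz => ?_
    simp only [mem_filter, mem_image, mem_univ, true_and] at hz
    obtain ⟨⟨x, rfl⟩, hP⟩ := hz
    have h1 : ({y ∈ ({x : G | P (x ^ e)} : Finset G) | y ^ e = x ^ e}) =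
        ({y : G | powMonoidHom e y = powMonoidHom e x} : Finset G) := by
      ext y
      simp only [mem_filter, mem_univ, true_and, powMonoidHom_apply, and_iff_right_iff_imp]
      intro h
      rwa [h]
    rw [h1, MonoidHom.card_fiber_eq_of_mem_range (powMonoidHom e : G →* G) (y := 1) ⟨x, rfl⟩
      ⟨1, by simp⟩, ← Nat.card_eq_fintype_card, ← IsCyclic.card_powMonoidHom_ker,
      Nat.card_eq_fintype_card, ← Fintype.card_subtype]
    exact Fintype.card_congr (Equiv.refl _)
  · intro x hx
    simp only [coe_filter, mem_image, mem_univ, true_and, Set.mem_ofPred_eq] at hx ⊢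
    exact ⟨⟨x, rfl⟩, hx⟩

theorem card_image_pow {G : Type*} [CommGroup G] [IsCyclic G] [Fintype G] [DecidableEq G] (e : ℕ) :
    (Fintype.card G).gcd e * #(univ.image fun x : G => x ^ e) = Fintype.card G := by
  simpa using (card_filter_pow (G := G) e fun _ => True).symm

theorem card_pow_eq_one_filter {G : Type*} [CommGroup G] [IsCyclic G] [Fintype G] [DecidableEq G]
    (e : ℕ) : #{x : G | x ^ e = 1} = (Fintype.card G).gcd e := by
  rw [card_filter_pow (G := G) e fun z => z = 1]
  have : ({z ∈ univ.image fun x : G => x ^ e | z = 1}) = ({1} : Finset G) := by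
    ext z
    simp only [mem_filter, mem_image, mem_univ, true_and, mem_singleton, and_iff_right_iff_imp]
    rintro rfl
    exact ⟨1, one_pow e⟩
  rw [this, card_singleton, mul_one]

end Cyclic

/-! ### Averaging over subfield orbits -/

section Niho
variable {p : ℕ} [Fact p.Prime] {F : Type*} [Field F] [Fintype F]

theorem card_fixed [DecidableEq F] {Q : ℕ} (hQ : 2 ≤ Q) (hcard : Fintype.card F = Q ^ 2) :
    #{y : F | y ^ Q = y} = Q := by
  have h : ({y : F | y ^ Q = y} : Finset F) =
      insert 0 (({x : Fˣ | x ^ (Q - 1) = 1} : Finset Fˣ).map ⟨Units.val, Units.val_injective⟩) := by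
    ext y
    simp only [mem_filter, mem_univ, true_and, mem_insert, mem_map, Function.Embedding.coeFn_mk]
    constructor
    · intro hy
      rcases eq_or_ne y 0 with h0 | h0
      · exact Or.inl h0
      · refine Or.inr ⟨Units.mk0 y h0, ?_, rfl⟩
        ext
        rw [Units.val_pow_eq_pow_val, Units.val_mk0, Units.val_one]
        refine mul_right_cancel₀ h0 ?_
        rw [← pow_succ, Nat.sub_add_cancel (by omega), hy, one_mul]
    · rintro (rfl | ⟨x, hx, rfl⟩)
      · exact zero_pow (by omega)
      · rw [← Units.val_pow_eq_pow_val, ← Nat.sub_add_cancel (show 1 ≤ Q by omega), pow_succ, hx,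
          one_mul]
  rw [h, card_insert_of_notMem (by simp), card_map, card_pow_eq_one_filter, Fintype.card_units,
    hcard, Nat.gcd_eq_right, Nat.sub_add_cancel (by omega)]
  simpa using Nat.sub_dvd_pow_sub_pow Q 1 2

variable [Algebra (ZMod p) F]

/-- Orbit averaging of a trace sum over the scalars fixed by `x ↦ x ^ p ^ m`. -/
theorem sum_traceChar_homogeneous [CharP F p] [DecidableEq F] (hp : Odd p) {m : ℕ} (hm : 1 ≤ m)
    (hcard : Fintype.card F = (p ^ m) ^ 2) {ζ : ℂ} (hζ : IsPrimitiveRoot ζ p)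
    (φ : F → F) (hφ0 : φ 0 = 0) (hφ : ∀ y x : F, y ^ p ^ m = y → φ (y * x) = y * φ x) :
    ((p : ℂ) ^ m) ^ 2 - 1 + ((p : ℂ) ^ m - 1) * (∑ x, traceChar F hζ.pow_eq_one (φ x) - 1) =
      (p : ℂ) ^ m * #{x : Fˣ | φ x ^ p ^ m + φ x = 0} := by
  have hp2 := (Fact.out : p.Prime).two_le
  have hQ : 2 ≤ p ^ m := hp2.trans (Nat.le_self_pow (by omega) p)
  have hinv (x : F) : (x ^ p ^ m) ^ p ^ m = x := by
    rw [← pow_mul, ← sq, ← hcard, FiniteField.pow_card]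
  have hunits (g : F → ℂ) : ∑ x : F, g x = ∑ x : Fˣ, g x + g 0 := by
    rw [← sum_erase_add _ _ (mem_univ 0)]
    congr 1
    symm
    refine sum_bij (fun x _ => (x : F)) (by simp) (fun _ _ _ _ h => Units.ext h) ?_ (by simp)
    intro y hy
    exact ⟨Units.mk0 y (ne_of_mem_erase hy), mem_univ _, rfl⟩
  have hcount : ∑ x : Fˣ, ∑ y : F with y ^ p ^ m = y, traceChar F hζ.pow_eq_one (y * φ x) =
      (p : ℂ) ^ m * #{x : Fˣ | φ x ^ p ^ m + φ x = 0} := by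
    simp_rw [sum_traceChar_mul_fixed hp hinv hζ, card_fixed hQ hcard]
    rw [← sum_filter, sum_const, nsmul_eq_mul, mul_comm]
    push_cast
    rfl
  -- The term y = 0 gives Q² - 1; each of the Q - 1 others gives the full sum minus 1, by
  -- substituting yx for x.
  rw [← hcount, sum_comm, ← sum_erase_add ({y : F | y ^ p ^ m = y} : Finset F) _ (a := 0) (by simp; omega)]
  have hne : ∀ y ∈ ({y : F | y ^ p ^ m = y} : Finset F).erase 0,
      ∑ x : Fˣ, traceChar F hζ.pow_eq_one (y * φ x) =
        ∑ x, traceChar F hζ.pow_eq_one (φ x) - 1 := by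
    intro y hy
    rw [mem_erase, mem_filter] at hy
    rw [hunits, hφ0, AddChar.map_zero_eq_one, add_sub_cancel_right]
    refine Fintype.sum_equiv (Equiv.mulLeft (Units.mk0 y hy.1)) _ _ fun x => ?_
    rw [Equiv.coe_mulLeft, Units.val_mul, Units.val_mk0, hφ y x hy.2.2]
  have hz : ∀ x : Fˣ, traceChar F hζ.pow_eq_one (0 * φ x) = 1 := by simp
  simp_rw [hz]
  rw [sum_congr rfl hne, sum_const, card_erase_of_mem (by simp; omega), card_fixed hQ hcard,
    sum_const, card_univ, Fintype.card_units, hcard, nsmul_eq_mul, nsmul_eq_mul,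
    Nat.cast_sub (by omega), Nat.cast_sub (Nat.one_le_pow _ _ (by omega))]
  push_cast
  ring

end Niho

/-! ### From the trace condition to roots of the cubic -/

/-- The image of the multiplicative group under the `e`-th power map. -/
noncomputable def unitsPowers (F : Type*) [Field F] [Fintype F] [DecidableEq F] (e : ℕ) :
    Finset F :=
  (univ.image fun x : Fˣ => x ^ e).map ⟨Units.val, Units.val_injective⟩

section Roots
variable {F : Type*} [Field F] [Fintype F]

theorem niho_trace_eq_zero_iff {Q k : ℕ} (hQ : 2 ≤ Q) (hcard : Fintype.card F = Q ^ 2)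
    (hadd : ∀ x y : F, (x + y) ^ Q = x ^ Q + y ^ Q) (a b : F) (x : Fˣ) :
    (a * (x : F) ^ ((k + 1) * (Q - 1) + 1) + b * (x : F) ^ ((3 * k + 2) * (Q - 1) + 1)) ^ Q +
      (a * (x : F) ^ ((k + 1) * (Q - 1) + 1) + b * (x : F) ^ ((3 * k + 2) * (Q - 1) + 1)) = 0 ↔
    conjCubic Q a b ((x ^ ((Q - 1) * (2 * k + 1)) : Fˣ) : F) = 0 := by
  have hx : (x : F) ≠ 0 := x.ne_zero
  obtain ⟨w, hw⟩ : ∃ w : F, w = (x : F) ^ (Q - 1) := ⟨_, rfl⟩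
  have hw0 : w ≠ 0 := hw ▸ pow_ne_zero _ hx
  have hxQ : (x : F) ^ Q = x * w := by
    rw [hw, ← pow_succ', Nat.sub_add_cancel (by omega)]
  have hwQ : w ^ Q * w = 1 := by
    have h1 : (x : F) * (w ^ Q * w) = x := by
      calc (x : F) * (w ^ Q * w) = ((x : F) * w) * w ^ Q := by ring
        _ = ((x : F) ^ Q) ^ Q := by rw [← hxQ, ← mul_pow, ← hxQ]
        _ = x := by rw [← pow_mul, ← sq, ← hcard, FiniteField.pow_card]
    exact mul_left_cancel₀ hx (by rw [h1, mul_one])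
  have hd (s : ℕ) : (x : F) ^ (s * (Q - 1) + 1) = x * w ^ s := by
    rw [pow_succ, mul_comm s, pow_mul, ← hw, mul_comm]
  have hz : ((x ^ ((Q - 1) * (2 * k + 1)) : Fˣ) : F) = w ^ (2 * k + 1) := by
    rw [Units.val_pow_eq_pow_val, pow_mul, ← hw]
  rw [hd, hd, hz, hadd, mul_pow, mul_pow, mul_pow, mul_pow, hxQ, ← pow_mul, ← pow_mul,
    mul_comm (k + 1) Q, mul_comm (3 * k + 2) Q, pow_mul, pow_mul]
  -- With w = x^(Q-1) and w^Q = w⁻¹, multiplying the left side by w^(3k+1) turns it into x times the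
  -- cubic at w^(2k+1).
  rw [← mul_eq_zero_iff_right (pow_ne_zero (3 * k + 1) hw0),
    ← mul_eq_zero_iff_left hx (b := conjCubic Q a b (w ^ (2 * k + 1)))]
  refine Eq.congr ?_ rfl
  have h1 : (w ^ Q) ^ (k + 1) * w ^ (k + 1) = 1 := by rw [← mul_pow, hwQ, one_pow]
  have h2 : (w ^ Q) ^ (3 * k + 2) * w ^ (3 * k + 2) = 1 := by rw [← mul_pow, hwQ, one_pow]
  simp only [conjCubic]
  linear_combination (x * a ^ Q * w ^ (2 * k + 1)) * h1 + (x * b ^ Q) * h2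

variable [DecidableEq F]

theorem gcd_sq_sub_one_mul {Q : ℕ} (u : ℕ) :
    (Q ^ 2 - 1).gcd ((Q - 1) * u) = (Q - 1) * u.gcd (Q + 1) := by
  rw [show Q ^ 2 - 1 = (Q - 1) * (Q + 1) by rw [mul_comm]; simpa using Nat.sq_sub_sq Q 1,
    Nat.gcd_mul_left, Nat.gcd_comm]

theorem gcd_mul_card_unitsPowers {Q : ℕ} (hQ : 2 ≤ Q) (hcard : Fintype.card F = Q ^ 2) (u : ℕ) :
    u.gcd (Q + 1) * #(unitsPowers F ((Q - 1) * u)) = Q + 1 := by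
  have h := card_image_pow (G := Fˣ) ((Q - 1) * u)
  rw [Fintype.card_units, hcard, gcd_sq_sub_one_mul, mul_assoc,
    show Q ^ 2 - 1 = (Q - 1) * (Q + 1) by rw [mul_comm]; simpa using Nat.sq_sub_sq Q 1] at h
  rw [unitsPowers, card_map]
  exact Nat.eq_of_mul_eq_mul_left (by omega) h

theorem pow_eq_one_of_mem_unitsPowers {Q : ℕ} (hcard : Fintype.card F = Q ^ 2)
    (u : ℕ) {z : F} (hz : z ∈ unitsPowers F ((Q - 1) * u)) : z ^ (Q + 1) = 1 := by
  simp only [unitsPowers, mem_map, mem_image, mem_univ, true_and, Function.Embedding.coeFn_mk] at hz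
  obtain ⟨_, ⟨x, rfl⟩, rfl⟩ := hz
  rw [← Units.val_pow_eq_pow_val, ← pow_mul, mul_right_comm,
    show (Q - 1) * (Q + 1) = Fintype.card Fˣ by
      rw [Fintype.card_units, hcard, mul_comm]; simpa using (Nat.sq_sub_sq Q 1).symm,
    pow_mul, pow_card_eq_one, one_pow, Units.val_one]

theorem card_units_conjCubic {Q : ℕ} (hcard : Fintype.card F = Q ^ 2)
    (u : ℕ) (a b : F) :
    #{x : Fˣ | conjCubic Q a b ((x ^ ((Q - 1) * u) : Fˣ) : F) = 0} =
      (Q - 1) * u.gcd (Q + 1) * #{z ∈ unitsPowers F ((Q - 1) * u) | conjCubic Q a b z = 0} := by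
  rw [card_filter_pow (G := Fˣ) _ fun z => conjCubic Q a b (z : F) = 0, Fintype.card_units, hcard,
    gcd_sq_sub_one_mul, unitsPowers, filter_map, card_map]
  rfl

end Roots

theorem expSum_niho {p : ℕ} [Fact p.Prime] (hp : Odd p) {m : ℕ} (hm : 1 ≤ m)
    {F : Type*} [Field F] [Fintype F] [DecidableEq F] [Algebra (ZMod p) F] [CharP F p]
    (hcard : Fintype.card F = (p ^ m) ^ 2) {ζ : ℂ} (hζ : IsPrimitiveRoot ζ p) (k : ℕ) (a b : F) :
    expSum p ζ (nihoExponent p m (k + 1)) (nihoExponent p m (3 * k + 2)) a b =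
      (((2 * k + 1).gcd (p ^ m + 1) : ℂ) * #{z ∈ unitsPowers F ((p ^ m - 1) * (2 * k + 1)) |
        conjCubic (p ^ m) a b z = 0} - 1) * (p : ℂ) ^ m := by
  have hp2 := (Fact.out : p.Prime).two_le
  have hQ : 2 ≤ p ^ m := hp2.trans (Nat.le_self_pow (by omega) p)
  have hfix (s : ℕ) (y x : F) (hy : y ^ p ^ m = y) :
      (y * x) ^ (s * (p ^ m - 1) + 1) = y * x ^ (s * (p ^ m - 1) + 1) := by
    rw [mul_pow]
    congr 1
    rcases eq_or_ne y 0 with rfl | h0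
    · simp
    · have : y ^ (p ^ m - 1) = 1 := mul_right_cancel₀ h0 (by
        rw [← pow_succ, Nat.sub_add_cancel (by omega), hy, one_mul])
      rw [pow_succ, mul_comm s, pow_mul, this, one_pow, one_mul]
  have h := sum_traceChar_homogeneous hp hm hcard hζ
    (fun x => a * x ^ ((k + 1) * (p ^ m - 1) + 1) + b * x ^ ((3 * k + 2) * (p ^ m - 1) + 1))
    (by simp) (fun y x hy => by rw [hfix _ y x hy, hfix _ y x hy]; ring)
  simp_rw [niho_trace_eq_zero_iff hQ hcard (fun x y => add_pow_char_pow x y p m)] at h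
  rw [card_units_conjCubic hcard] at h
  have h1 : (p : ℂ) ^ m - 1 ≠ 0 := by
    rw [sub_ne_zero]
    exact_mod_cast (show p ^ m ≠ 1 by omega)
  simp only [expSum, nihoExponent]
  simp only [traceChar_apply] at h
  refine mul_left_cancel₀ h1 ?_
  push_cast [Nat.cast_sub (show 1 ≤ p ^ m by omega)] at h
  linear_combination h

/-! ### Solving the moment equations -/

section Counts

theorem cast_choose_three (K : Type*) [Field K] [CharZero K] (n : ℕ) :
    (n.choose 3 : K) = n * (n - 1) * (n - 2) / 6 := by
  have h : (n.choose 3 : K) * 3 = n.choose 2 * (n - 2) := by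
    rcases le_or_gt 2 n with hn | hn
    · have h := congrArg (Nat.cast (R := K)) (Nat.choose_succ_right_eq n 2)
      push_cast [Nat.cast_sub hn] at h
      linear_combination h
    · interval_cases n <;> simp [Nat.choose]
  rw [Nat.cast_choose_two] at h
  linear_combination h / 3

/-- Root-number distribution of a family whose binomial moments up to order three are those of
`Q ^ 4` cubics in general position with respect to `M` points. -/
theorem counts_of_binomial_moments {Q M : ℕ} (n : ℕ → ℕ)
    (h : ∀ k ≤ 4, ∑ i ∈ range 4, n i * i.choose k + M.choose k = M.choose k * Q ^ (4 - k)) :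
    (n 3 : ℚ) = M * (M - 1) * (M - 2) / 6 * (Q - 1) ∧
    (n 2 : ℚ) = M * (M - 1) / 2 * (Q - 1) * (Q + 3 - M) ∧
    (n 1 : ℚ) = M * (Q - 1) * (Q ^ 2 + Q + 1 - (M - 1) * (Q + 1) + (M - 1) * (M - 2) / 2) ∧
    (n 0 : ℚ) = (Q - 1) * (Q ^ 3 + Q ^ 2 + Q + 1 - M * (Q ^ 2 + Q + 1)
      + M * (M - 1) / 2 * (Q + 1) - M * (M - 1) * (M - 2) / 6) := by
  have h0 := congrArg (Nat.cast (R := ℚ)) (h 0 (by norm_num))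
  have h1 := congrArg (Nat.cast (R := ℚ)) (h 1 (by norm_num))
  have h2 := congrArg (Nat.cast (R := ℚ)) (h 2 (by norm_num))
  have h3 := congrArg (Nat.cast (R := ℚ)) (h 3 (by norm_num))
  simp only [sum_range_succ, range_zero, sum_empty, Nat.choose_zero_right, Nat.choose_one_right,
    show Nat.choose 0 2 = 0 from rfl, show Nat.choose 1 2 = 0 from rfl,
    show Nat.choose 2 2 = 1 from rfl, show Nat.choose 3 2 = 3 from rfl,
    show Nat.choose 0 3 = 0 from rfl, show Nat.choose 1 3 = 0 from rfl,
    show Nat.choose 2 3 = 0 from rfl, show Nat.choose 3 3 = 1 from rfl,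
    Nat.cast_add, Nat.cast_mul, Nat.cast_pow, Nat.cast_choose_two, cast_choose_three,
    Nat.reduceSub, Nat.cast_ofNat, Nat.cast_one, Nat.cast_zero] at h0 h1 h2 h3
  refine ⟨?_, ?_, ?_, ?_⟩
  · linear_combination h3
  · linear_combination h2 - 3 * h3
  · linear_combination h1 - 2 * h2 + 3 * h3
  · linear_combination h0 - h1 + h2 - h3

theorem counts_pos_of_binomial_moments {Q M : ℕ} (hM : 4 ≤ M) (hMQ : M ≤ Q + 1) (n : ℕ → ℕ)
    (h : ∀ k ≤ 4, ∑ i ∈ range 4, n i * i.choose k + M.choose k = M.choose k * Q ^ (4 - k))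
    {i : ℕ} (hi : i < 4) : 0 < n i := by
  obtain ⟨h3, h2, h1, h0⟩ := counts_of_binomial_moments n h
  obtain ⟨s, rfl⟩ := Nat.exists_eq_add_of_le hM
  -- In the slacks s = M - 4 and r = Q + 1 - M, the expressions left to `positivity` have
  -- nonnegative coefficients.
  obtain ⟨r, rfl⟩ : ∃ r, Q = s + 3 + r := ⟨Q - (s + 3), by omega⟩
  have hs : (0 : ℚ) ≤ s := s.cast_nonneg
  have hr : (0 : ℚ) ≤ r := r.cast_nonneg
  push_cast at h0 h1 h2 h3
  interval_cases i
  · suffices (0 : ℚ) < n 0 by exact_mod_cast this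
    rw [h0]
    refine mul_pos (by linarith) ?_
    ring_nf
    positivity
  · suffices (0 : ℚ) < n 1 by exact_mod_cast this
    rw [h1]
    refine mul_pos (mul_pos (by linarith) (by linarith)) ?_
    ring_nf
    positivity
  · suffices (0 : ℚ) < n 2 by exact_mod_cast this
    rw [h2]
    ring_nf
    positivity
  · suffices (0 : ℚ) < n 3 by exact_mod_cast this
    rw [h3]
    ring_nf
    positivity

end Counts

/-! ### The value distribution -/

theorem theorem5 (p m t s₁ s₂ d₁ d₂ l : ℕ) [Fact p.Prime] (hp : Odd p) (hm : 1 ≤ m)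
    {F : Type*} [Field F] [Fintype F] [Algebra (ZMod p) F]
    (hF : Fintype.card F = p ^ (2 * m))
    (ζ : ℂ) (hζ : IsPrimitiveRoot ζ p)
    (ht : t ≡ 2 [MOD 4]) (ht' : ¬ t ≡ 0 [MOD p ^ m + 1])
    (hs₁ : 4 * s₁ = t + 2) (hs₂ : 4 * s₂ = 3 * t + 2)
    (hd₁ : d₁ = nihoExponent p m s₁) (hd₂ : d₂ = nihoExponent p m s₂)
    (hl : l = Nat.gcd t (p ^ m + 1)) :
    expSum p ζ d₁ d₂ (0 : F) 0 = (p : ℂ) ^ (2 * m) ∧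
    {v : ℂ | ∃ a b : F, (a, b) ≠ (0, 0) ∧ expSum p ζ d₁ d₂ a b = v} =
      {-(p : ℂ) ^ m, ((l : ℂ) / 2 - 1) * (p : ℂ) ^ m, ((l : ℂ) - 1) * (p : ℂ) ^ m,
        (3 * (l : ℂ) / 2 - 1) * (p : ℂ) ^ m} ∧
    frequency (expSum p (F := F) ζ d₁ d₂) ((p : ℂ) ^ (2 * m)) = 1 ∧
    (frequency (expSum p (F := F) ζ d₁ d₂) ((3 * (l : ℂ) / 2 - 1) * (p : ℂ) ^ m) : ℚ) =
      2 * ((p : ℚ) ^ (2 * m) - 1) * ((l : ℚ) - (p : ℚ) ^ m - 1) *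
        ((l : ℚ) - 2 * (p : ℚ) ^ m - 2) / (3 * (l : ℚ) ^ 3) ∧
    (frequency (expSum p (F := F) ζ d₁ d₂) (((l : ℂ) - 1) * (p : ℂ) ^ m) : ℚ) =
      ((p : ℚ) ^ (2 * m) - 1) * (2 * (p : ℚ) ^ m + 2 - ((p : ℚ) ^ m + 3) * (l : ℚ)) *
        ((l : ℚ) - 2 * (p : ℚ) ^ m - 2) / (l : ℚ) ^ 3 ∧
    (frequency (expSum p (F := F) ζ d₁ d₂) (((l : ℂ) / 2 - 1) * (p : ℂ) ^ m) : ℚ) =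
      2 * ((p : ℚ) ^ (2 * m) - 1) *
        (((p : ℚ) ^ (2 * m) + 2 * (p : ℚ) ^ m + 3) * (l : ℚ) ^ 2
          - (2 * (p : ℚ) ^ (2 * m) + 7 * (p : ℚ) ^ m + 5) * (l : ℚ)
          + 2 * ((p : ℚ) ^ m + 1) ^ 2) / (l : ℚ) ^ 3 ∧
    (frequency (expSum p (F := F) ζ d₁ d₂) (-(p : ℂ) ^ m) : ℚ) =
      ((p : ℚ) ^ (2 * m) - 1) *
        (3 * ((p : ℚ) ^ (2 * m) + 1) * (l : ℚ) ^ 3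
          - (6 * (p : ℚ) ^ (2 * m) + 9 * (p : ℚ) ^ m + 11) * (l : ℚ) ^ 2
          + 6 * ((p : ℚ) ^ (2 * m) + 3 * (p : ℚ) ^ m + 2) * (l : ℚ)
          - 4 * ((p : ℚ) ^ m + 1) ^ 2) / (3 * (l : ℚ) ^ 3) := by
  classical
  have : CharP F p := charP_of_injective_algebraMap (algebraMap (ZMod p) F).injective p
  obtain ⟨k, rfl⟩ : ∃ k, t = 4 * k + 2 := by
    have : t % 4 = 2 := ht
    exact ⟨t / 4, by omega⟩
  obtain rfl : s₁ = k + 1 := by omega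
  obtain rfl : s₂ = 3 * k + 2 := by omega
  subst hd₁ hd₂
  have hp2 := (Fact.out : p.Prime).two_le
  have hQ : 2 ≤ p ^ m := hp2.trans (Nat.le_self_pow (by omega) p)
  have hcard : Fintype.card F = (p ^ m) ^ 2 := by rw [hF, mul_comm, pow_mul]
  have hinv (x : F) : (x ^ p ^ m) ^ p ^ m = x := by
    rw [← pow_mul, ← sq, ← hcard, FiniteField.pow_card]
  have hT (a b : F) := expSum_niho hp hm hcard hζ k a b
  have hHM := gcd_mul_card_unitsPowers hQ hcard (2 * k + 1)
  have hHU (z : F) := pow_eq_one_of_mem_unitsPowers hcard (2 * k + 1) (z := z)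
  obtain ⟨r, hr⟩ : ∃ r, p ^ m + 1 = 2 * r := by
    obtain ⟨r, hr⟩ := hp.pow (n := m)
    exact ⟨r + 1, by omega⟩
  have hlg : l = 2 * (2 * k + 1).gcd (p ^ m + 1) := by
    have hcop : Nat.Coprime 2 (2 * k + 1) := by simp
    rw [hl, show 4 * k + 2 = 2 * (2 * k + 1) by ring, hr, Nat.gcd_mul_left,
      Nat.Coprime.gcd_mul_left_cancel_right _ hcop]
  have hodd : Odd ((2 * k + 1).gcd (p ^ m + 1)) :=
    Odd.of_dvd_nat ⟨k, rfl⟩ (Nat.gcd_dvd_left _ _)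
  have hldvd : l ∣ 4 * k + 2 := hl ▸ Nat.gcd_dvd_left _ _
  generalize hH : unitsPowers F ((p ^ m - 1) * (2 * k + 1)) = H at hT hHM hHU
  generalize hg : (2 * k + 1).gcd (p ^ m + 1) = g at hT hHM hlg hodd
  have hg0 : 0 < g := hodd.pos
  -- g·#H = Q + 1 is even and g is odd, so #H is even; #H = 2 would make Q + 1 = l a divisor of t,
  -- which is excluded.
  have hM4 : 4 ≤ #H := by
    have heven : Even #H := by
      have h1 : Even (g * #H) := ⟨r, by omega⟩
      exact (Nat.even_mul.1 h1).resolve_left (Nat.not_even_iff_odd.2 hodd)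
    have h0 : #H ≠ 0 := by
      intro h
      simp [h] at hHM
    have h2 : #H ≠ 2 := by
      intro h
      apply ht'
      rw [Nat.modEq_zero_iff_dvd, ← hHM, h, mul_comm, ← hlg]
      exact hldvd
    obtain ⟨j, hj⟩ := heven
    omega
  have hMQ : #H ≤ p ^ m + 1 := by
    rw [← hHM]
    exact Nat.le_mul_of_pos_left _ hg0
  have hmom := fun k hk => sum_choose_card_roots_ne_zero hQ hcard
    (fun x y => add_pow_char_pow x y p m) hinv H hHU hM4 (k := k) hk
  have hcount := counts_of_binomial_moments _ hmom
  have hpos := fun i hi => counts_pos_of_binomial_moments hM4 hMQ _ hmom (i := i) hi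
  have hP0 : ((p : ℂ) ^ m) ≠ 0 := by exact_mod_cast (show p ^ m ≠ 0 by omega)
  have hgC : (g : ℂ) ≠ 0 := by exact_mod_cast hg0.ne'
  have hval (i : ℕ) (ab : F × F) :
      expSum p ζ (nihoExponent p m (k + 1)) (nihoExponent p m (3 * k + 2)) ab.1 ab.2 =
        ((g : ℂ) * i - 1) * (p : ℂ) ^ m ↔ #{z ∈ H | conjCubic (p ^ m) ab.1 ab.2 z = 0} = i := by
    rw [hT, mul_left_inj' hP0, sub_left_inj, mul_right_inj' hgC, Nat.cast_inj]
  have hzero : #{z ∈ H | conjCubic (p ^ m) (0 : F) 0 z = 0} = #H := by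
    congr 1
    rw [filter_eq_self]
    intro z _
    simp [conjCubic, show p ≠ 0 by omega]
  have hle (ab : F × F) (hab : ab ≠ 0) : #{z ∈ H | conjCubic (p ^ m) ab.1 ab.2 z = 0} ≤ 3 :=
    card_le_three_of_conjCubic_eq_zero (a := ab.1) (b := ab.2) hab _ fun z hz => (mem_filter.1 hz).2
  have hsq : (p : ℂ) ^ (2 * m) = ((g : ℂ) * (#H : ℕ) - 1) * (p : ℂ) ^ m := by
    have : (g : ℂ) * (#H : ℕ) = (p : ℂ) ^ m + 1 := by exact_mod_cast hHM
    rw [this, two_mul, pow_add]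
    ring
  have hfreq (i : ℕ) (hi : i < 4) : frequency
      (expSum p (F := F) ζ (nihoExponent p m (k + 1)) (nihoExponent p m (3 * k + 2)))
        (((g : ℂ) * i - 1) * (p : ℂ) ^ m) =
      #{ab : F × F | ab ≠ 0 ∧ #{z ∈ H | conjCubic (p ^ m) ab.1 ab.2 z = 0} = i} := by
    rw [frequency, Nat.card_eq_fintype_card, Fintype.card_subtype]
    congr 1
    ext ab
    simp only [hval, mem_filter, mem_univ, true_and]
    -- The zero pair has #H ≥ 4 roots, so it never meets i < 4.
    refine ⟨fun h => ⟨?_, h⟩, And.right⟩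
    rintro rfl
    rw [Prod.fst_zero, Prod.snd_zero, hzero] at h
    omega
  have hlC : (l : ℂ) = 2 * g := by exact_mod_cast hlg
  have hv0 : -(p : ℂ) ^ m = ((g : ℂ) * (0 : ℕ) - 1) * (p : ℂ) ^ m := by push_cast; ring
  have hv1 : ((l : ℂ) / 2 - 1) * (p : ℂ) ^ m = ((g : ℂ) * (1 : ℕ) - 1) * (p : ℂ) ^ m := by
    rw [hlC]; push_cast; ring
  have hv2 : ((l : ℂ) - 1) * (p : ℂ) ^ m = ((g : ℂ) * (2 : ℕ) - 1) * (p : ℂ) ^ m := by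
    rw [hlC]; push_cast; ring
  have hv3 : (3 * (l : ℂ) / 2 - 1) * (p : ℂ) ^ m = ((g : ℂ) * (3 : ℕ) - 1) * (p : ℂ) ^ m := by
    rw [hlC]; push_cast; ring
  have hQQ : (p : ℚ) ^ (2 * m) = ((p : ℚ) ^ m) ^ 2 := by rw [mul_comm, pow_mul]
  have hlQ : (l : ℚ) = 2 * g := by exact_mod_cast hlg
  have hgQ : (g : ℚ) ≠ 0 := by exact_mod_cast hg0.ne'
  have hHMQ : (p : ℚ) ^ m = g * (#H : ℕ) - 1 := by
    rw [eq_sub_iff_add_eq]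
    exact_mod_cast hHM.symm
  rw [hv0, hv1, hv2, hv3]
  refine ⟨?_, ?_, ?_, ?_, ?_, ?_, ?_⟩
  · rw [hsq]
    exact (hval _ (0, 0)).2 hzero
  · ext v
    simp only [Set.mem_ofPred_eq, Set.mem_insert_iff, Set.mem_singleton_iff]
    constructor
    · rintro ⟨a, b, hab, rfl⟩
      simp only [hval _ (a, b)]
      have := hle (a, b) hab
      dsimp only at this ⊢
      omega
    · have hex (i : ℕ) (hi : i < 4) : ∃ a b : F, (a, b) ≠ (0, 0) ∧
          expSum p ζ (nihoExponent p m (k + 1)) (nihoExponent p m (3 * k + 2)) a b =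
            ((g : ℂ) * i - 1) * (p : ℂ) ^ m := by
        obtain ⟨ab, hab⟩ := card_pos.1 (hpos i hi)
        simp only [mem_filter, mem_univ, true_and] at hab
        exact ⟨ab.1, ab.2, hab.1, (hval i ab).2 hab.2⟩
      rintro (rfl | rfl | rfl | rfl)
      exacts [hex 0 (by omega), hex 1 (by omega), hex 2 (by omega), hex 3 (by omega)]
  · rw [hsq, frequency, Nat.card_eq_fintype_card, Fintype.card_subtype, card_eq_one]
    refine ⟨0, ?_⟩
    ext ab
    simp only [hval, mem_filter, mem_univ, true_and, mem_singleton]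
    constructor
    · intro h
      by_contra h0
      have := hle ab h0
      omega
    · rintro rfl
      exact hzero
  · rw [hfreq 3 (by omega), hcount.1, hQQ, Nat.cast_pow, hHMQ, hlQ]
    field_simp
    ring
  · rw [hfreq 2 (by omega), hcount.2.1, hQQ, Nat.cast_pow, hHMQ, hlQ]
    field_simp
    ring
  · rw [hfreq 1 (by omega), hcount.2.2.1, hQQ, Nat.cast_pow, hHMQ, hlQ]
    field_simp
    ring
  · rw [hfreq 0 (by omega), hcount.2.2.2, hQQ, Nat.cast_pow, hHMQ, hlQ]
    field_simp
    ring
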